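/- Let $\mathcal A$ be a finite alphabet with the discrete topology and $\sigma$-algebra, let $\mathbb L=\{\dots,-2,-1,0\}$, and let $\Omega=\mathcal A^{\mathbb L}$ carry the product topology and the product $\sigma$-algebra $\mathcal F$. For $\Lambda\subset\mathbb L$ let $\mathcal F_\Lambda\subset\mathcal F$ be the $\sigma$-algebra generated by the coordinates in $\Lambda$, and write $\mathcal F_{\le i}$, $\mathcal F_{\le i-1}$ for $\Lambda=\{j\le i\}$, $\{j\le i-1\}$. A left singleton-specification (LSS) on $\Omega$ is a family $f=(f_i)_{i\in\mathbb L}$ of probability kernels $f_i:\mathcal F_{\le i}\times\Omega\to[0,1]$ (each $f_i(\cdot\mid\omega)$ is a probability measure on $(\Omega,\mathcal F_{\le i})$) such that for every $i$: (a) $f_i(B\mid\cdot)$ is $\mathcal F_{\le i-1}$-measurable for every $B\in\mathcal F_{\le i}$; (b) $f_i(B\mid\omega)=\mathbf 1_B(\omega)$ for every $B\in\mathcal F_{\le i-1}$ and $\omega\in\Omega$. Write $f_i(a\mid\omega)=f_i(\{\sigma:\sigma_i=a\}\mid\omega)$; this depends on $\omega$ only through $\omega_{-\infty}^{i-1}=(\omega_j)_{j\le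 i-1}$. The LSS is regular if, for all $i\in\mathbb L$ and $a\in\mathcal A$, the function $f_i(a\mid\cdot)$ is continuous and strictly positive on $\Omega$. Let $\mathcal S$ be the set of finite subsets of $\mathbb L$. A potential is a family $\phi=(\phi_A)_{A\in\mathcal S}$ of functions $\phi_A:\Omega\to\mathbb R$ with $\phi_A$ $\mathcal F_A$-measurable; it is absolutely and uniformly summable if $\sum_{A\in\mathcal S,\,A\ni i}\|\phi_A\|_\infty<\infty$ for every $i\in\mathbb L$, where $\|\cdot\|_\infty$ is the supremum norm. **Theorem.** For every regular LSS $f$ on $\Omega$ there exists an absolutely and uniformly summable potential $\phi$ such that, for every $i\in\mathbb L$ and $\omega\in\Omega$, $$ f_i(\omega_i\mid\omega_{-\infty}^{i-1})= \frac{\displaystyle\sum_{\sigma\in\mathcal A^{[i+1,0]}}\exp\Bigl[-\sum_{A\in\mathcal S:\ A\cap[i,0]\ne\emptyset}\phi_A\bigl(\sigma_{i+1}^0\,\omega_{-\infty}^{i}\bigr)\Bigr]} {\displaystyle\sum_{\sigma\in\mathcal A^{[i,0]}}\exp\Bigl[-\sum_{A\in\mathcal S:\ A\cap[i,0]\ne\emptyset}\phi_A\bigl(\sigma_{i}^0\,\omega_{-\infty}^{i-1}\bigr)\Bigr]},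 $$ where $\sigma_k^0\,\omega_{-\infty}^{k-1}$ denotes the configuration equal to $\sigma$ on $[k,0]$ and to $\omega$ on $\{j\le k-1\}$, and for $i=0$ the numerator is the single term with configuration $\omega$ (as $[1,0]=\emptyset$). -/

import Mathlib

open MeasureTheory ProbabilityTheory

namespace HalfLine

/-- The half-line `ℤ⁻ = {…, -2, -1, 0}`. Its greatest element is `0`, so that `[i, 0] = Ici i`
and `[i + 1, 0] = Ioi i` (which is empty for `i = 0`). -/
abbrev NegInt : Type := Set.Iic (0 : ℤ)

/-- Configurations on the half-line over the alphabet `α`. -/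
abbrev Config (α : Type*) : Type _ := NegInt → α

/-- The σ-algebra `𝓕_Λ` on configurations generated by the coordinates in `Λ`. -/
abbrev sigmaOn (α : Type*) [MeasurableSpace α] (Λ : Set NegInt) : MeasurableSpace (Config α) :=
  cylinderEvents Λ

/-- The concatenation `σ_Λ ω_{Λᶜ}`. -/
def concat {α : Type*} (Λ : Finset NegInt) (σ : Λ → α) (ω : Config α) : Config α :=
  fun j => if h : j ∈ Λ then σ ⟨j, h⟩ else ω j

/-- A left singleton-specification (system of transition probabilities): probability kernels
`f_i` from configurations (with the full product σ-algebra) to configurations with the σ-algebra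
`𝓕_{≤ i}`. -/
structure LSS (α : Type*) [MeasurableSpace α] where
  kernel (i : NegInt) :
    @Kernel (Config α) (Config α) MeasurableSpace.pi (sigmaOn α (Set.Iic i))
  isProbability (i : NegInt) (ω : Config α) : IsProbabilityMeasure (kernel i ω)
  measurable_past (i : NegInt) (B : Set (Config α)) :
    MeasurableSet[sigmaOn α (Set.Iic i)] B →
      Measurable[sigmaOn α (Set.Iio i)] (fun ω => kernel i ω B)
  proper (i : NegInt) (B : Set (Config α)) :
    MeasurableSet[sigmaOn α (Set.Iio i)] B →
      ∀ ω, kernel i ω B = B.indicator 1 ω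

namespace LSS

variable {α : Type*} [MeasurableSpace α]

/-- The transition probability `f_i(a | ω)` of the cylinder `{σ | σ_i = a}`; it depends on `ω`
only through `(ω_j)_{j < i}`. -/
noncomputable def prob (f : LSS α) (i : NegInt) (a : α) (ω : Config α) : ℝ :=
  (f.kernel i ω {σ | σ i = a}).toReal

/-- Continuity of all `f_i(a | ·)`, for the product topology on configurations. -/
def IsContinuous [TopologicalSpace α] (f : LSS α) : Prop :=
  ∀ i a, Continuous (f.prob i a)

def IsNonNull (f : LSS α) : Prop :=
  ∀ i a ω, 0 < f.prob i a ω

def IsRegular [TopologicalSpace α] (f : LSS α) : Prop :=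
  f.IsContinuous ∧ f.IsNonNull

end LSS

/-- A potential: a real function `φ_A` of the configuration for each finite `A`,
measurable with respect to the coordinates in `A`. -/
structure Potential (α : Type*) [MeasurableSpace α] where
  toFun : Finset NegInt → Config α → ℝ
  measurable (A : Finset NegInt) : Measurable[sigmaOn α (A : Set NegInt)] (toFun A)

namespace Potential

variable {α : Type*} [MeasurableSpace α]

/-- Absolute and uniform summability: `∑_{A ∋ i} ‖φ_A‖_∞ < ∞` for every site `i`, where
`‖·‖_∞` is the supremum norm. The sum is taken in `[0, ∞]`. -/
def IsSummable (φ : Potential α) : Prop :=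
  ∀ i : NegInt, ∑' A : {A : Finset NegInt // i ∈ A}, (⨆ ω, ‖φ.toFun A.1 ω‖ₑ) < ⊤

/-- The energy `∑_{A ∩ Λ ≠ ∅} φ_A(ω)` of the window `Λ`; the series converges absolutely for an
absolutely and uniformly summable potential. -/
noncomputable def energy (φ : Potential α) (Λ : Finset NegInt) (ω : Config α) : ℝ :=
  ∑' A : {A : Finset NegInt // (A ∩ Λ).Nonempty}, φ.toFun A.1 ω

end Potential

end HalfLine

/-!
The potential is built so that the energy of `[i, 0]` is `-∑_{j ≥ i} log f_j(ω_j | ω)`. Its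
Boltzmann weight is then `∏_{j ≥ i} f_j(ω_j | ω)`. Summed over the coordinates in `[i, 0]` this
product gives `1`, by summing out the sites from right to left (`LSS.sum_exp_neg_siteEnergy`);
summed over those in `[i + 1, 0]` it gives `f_i(ω_i | ω)`, because this factor ignores the
coordinates to the right of `i` (`LSS.sum_exp_neg_insert`).

To realise such energies, each site energy `g_i = -log f_i(ω_i | ω)`, a continuous function of the
coordinates up to `i`, is written as a telescoping series of functions of the coordinates in windows
`[i - k_n, i]`. By uniform continuity the truncations of `g_i` to windows converge uniformly, and
with `k_n` growing fast enough the increments are summable in the supremum norm, whatever the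
modulus of continuity (`exists_hasSum_window`). The `n`-th term becomes the interaction of the set
`[i - k_n, i]`. A set of this kind that contains a site `i` ends at one of the finitely many sites
of `[i, 0]`, so summability at `i` only involves finitely many convergent series; here it
matters that the half-line is bounded on the right. Likewise the sets meeting `[i, 0]` are exactly
those ending in `[i, 0]`, which gives the energy (`exists_potential_energy_eq_sum`).
-/

namespace HalfLine

open Filter Topology

/-! ### Functions of finitely many coordinates -/

theorem dependsOn_of_measurable_sigmaOn {α β : Type*} [MeasurableSpace α] [MeasurableSpace β]
    [MeasurableSingletonClass β] {Λ : Set NegInt} {F : Config α → β}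
    (hF : Measurable[sigmaOn α Λ] F) : DependsOn F Λ := by
  have hle : sigmaOn α Λ ≤
      MeasurableSpace.comap (Λ.domRestrict (π := fun _ => α)) MeasurableSpace.pi := by
    refine iSup₂_le fun i hi => ?_
    have h : Measurable[MeasurableSpace.comap (Λ.domRestrict (π := fun _ => α))
        MeasurableSpace.pi] (fun σ : Config α => σ i) :=
      (measurable_pi_apply (X := fun _ : Λ => α) ⟨i, hi⟩).comp (comap_measurable _)
    exact h.comap_le
  have hF' := hF.mono hle le_rfl
  exact dependsOn_iff_factorsThrough.2 hF'.factorsThrough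

/-- No measurability of `F` is needed: it is a function on the finite discrete space `α ^ A`. -/
theorem measurable_sigmaOn_of_dependsOn {α : Type*} [Finite α] [MeasurableSpace α]
    [DiscreteMeasurableSpace α] {A : Finset NegInt} {F : Config α → ℝ}
    (hF : DependsOn F (A : Set NegInt)) : Measurable[sigmaOn α (A : Set NegInt)] F := by
  obtain ⟨h, rfl⟩ := dependsOn_iff_exists_comp.1 hF
  have hh : Measurable h := Measurable.of_discrete
  exact hh.comp (measurable_restrict_cylinderEvents _)

/-- The window `[i - m, i]` of the half-line. -/
noncomputable def window (i : NegInt) (m : ℕ) : Finset NegInt :=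
  Finset.Icc ⟨i.1 - m, by have := i.2; simp only [Set.mem_Iic] at *; omega⟩ i

theorem mem_window {i j : NegInt} {m : ℕ} : j ∈ window i m ↔ i.1 - m ≤ j.1 ∧ j ≤ i := by
  rw [window, Finset.mem_Icc]; rfl

theorem window_injective : Function.Injective fun p : NegInt × ℕ => window p.1 p.2 := by
  rintro ⟨i, m⟩ ⟨j, n⟩ h
  have h' : ∀ k, k ∈ window i m ↔ k ∈ window j n := fun k => by
    rw [show window i m = window j n from h]
  simp only [mem_window, ← Subtype.coe_le_coe] at h'
  have hi := i.2
  have hj := j.2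
  simp only [Set.mem_Iic] at hi hj
  have h1 := (h' i).1 ⟨by omega, le_rfl⟩
  have h2 := (h' j).2 ⟨by omega, le_rfl⟩
  have h3 := (h' ⟨i.1 - m, by simp only [Set.mem_Iic]; omega⟩).1 (by dsimp only; omega)
  have h4 := (h' ⟨j.1 - n, by simp only [Set.mem_Iic]; omega⟩).2 (by dsimp only; omega)
  dsimp only at h3 h4
  refine Prod.ext (Subtype.ext ?_) ?_ <;> dsimp only <;> omega

theorem window_inter_Ici_nonempty {i j : NegInt} {m : ℕ} :
    (window j m ∩ Finset.Ici i).Nonempty ↔ i ≤ j := by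
  constructor
  · rintro ⟨k, hk⟩
    rw [Finset.mem_inter, mem_window, Finset.mem_Ici] at hk
    exact hk.2.trans hk.1.2
  · intro h
    refine ⟨j, ?_⟩
    rw [Finset.mem_inter, mem_window, Finset.mem_Ici]
    exact ⟨⟨by omega, le_rfl⟩, h⟩

/-! ### Expansion of a continuous function along growing windows -/

/-- The configuration `ω` with every coordinate outside `A` replaced by that of the reference
configuration `η`. -/
noncomputable def truncate {α : Type*} (η : Config α) (A : Finset NegInt) (ω : Config α) :
    Config α :=
  fun j => if j ∈ A then ω j else η j

theorem dependsOn_truncate {α β : Type*} (η : Config α) (A : Finset NegInt) (g : Config α → β) :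
    DependsOn (fun ω => g (truncate η A ω)) (A : Set NegInt) := by
  intro x y h
  refine congrArg g (funext fun j => ?_)
  unfold truncate
  split_ifs with hj
  · exact h j hj
  · rfl

/-- A continuous function of the coordinates up to `i` is a uniform limit of its truncations to
the windows `[i - m, i]`: it is uniformly continuous, and each coordinate is truncated for finitely
many `m` only. -/
theorem eventually_abs_sub_truncate_lt {α : Type*} [Finite α] [TopologicalSpace α]
    [DiscreteTopology α] {g : Config α → ℝ} (hg : Continuous g) {i : NegInt}
    (hd : DependsOn g (Set.Iic i)) (η : Config α) {ε : ℝ} (hε : 0 < ε) :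
    ∀ᶠ m in atTop, ∀ ω, |g ω - g (truncate η (window i m) ω)| < ε := by
  -- This uniform structure induces the given topology of `α` definitionally, as that of the
  -- product needs.
  let u : UniformSpace α := uniformSpaceOfCompactR1
  have huc : UniformContinuous g := CompactSpace.uniformContinuous_of_continuous hg
  -- The truncation is applied below `i` only, where it converges to the identity.
  let T : ℕ → Config α → Config α := fun m ω j =>
    if j ≤ i then truncate η (window i m) ω j else ω j
  have hT : TendstoUniformly T id atTop := by
    rw [tendstoUniformly_iff_tendsto, Pi.uniformity, tendsto_iInf]
    intro j
    rw [tendsto_comap_iff]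
    refine Tendsto.mono_right ?_ refl_le_uniformity
    rw [tendsto_principal, eventually_prod_iff]
    refine ⟨fun m => i.1 - m ≤ j.1, ?_, fun _ => True, by simp, ?_⟩
    · filter_upwards [eventually_ge_atTop (i.1 - j.1).toNat] with m hm
      omega
    · intro m hm ω _
      change ω j = T m ω j
      by_cases hj : j ≤ i
      · have hmem : j ∈ window i m := mem_window.2 ⟨hm, hj⟩
        simp [T, truncate, hj, hmem]
      · simp [T, hj]
  have h := huc.comp_tendstoUniformly hT
  rw [Metric.tendstoUniformly_iff] at h
  filter_upwards [h ε hε] with m hm ω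
  have h1 := hm ω
  rw [Real.dist_eq] at h1
  have h2 : g (truncate η (window i m) ω) = g (T m ω) := by
    refine hd fun j hj => ?_
    rw [Set.mem_Iic] at hj
    simp [T, hj]
  rw [h2]
  exact h1

/-- The windows are chosen so sparse that the increments of the truncations are summable in the
supremum norm, although continuity gives no rate of convergence. -/
theorem exists_hasSum_window {α : Type*} [Finite α] [MeasurableSpace α]
    [DiscreteMeasurableSpace α] [TopologicalSpace α] [DiscreteTopology α] [Nonempty α]
    {g : Config α → ℝ} (hg : Continuous g) {i : NegInt} (hd : DependsOn g (Set.Iic i)) :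
    ∃ (k : ℕ → ℕ) (u : ℕ → Config α → ℝ) (b : ℕ → ℝ), StrictMono k ∧
      (∀ n, Measurable[sigmaOn α (window i (k n) : Set NegInt)] (u n)) ∧
      (∀ n ω, |u n ω| ≤ b n) ∧ Summable b ∧ ∀ ω, HasSum (fun n => u n ω) (g ω) := by
  obtain ⟨η⟩ : Nonempty (Config α) := inferInstance
  obtain ⟨k, hk, hkε⟩ := extraction_forall_of_eventually
    fun n : ℕ => eventually_abs_sub_truncate_lt hg hd η (ε := (1 / 2) ^ n) (by positivity)
  obtain ⟨C, hC⟩ := (isCompact_range hg).isBounded.exists_norm_le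
  let G : ℕ → Config α → ℝ := fun n ω => g (truncate η (window i (k n)) ω)
  let u : ℕ → Config α → ℝ := fun n => n.casesOn (G 0) fun m ω => G (m + 1) ω - G m ω
  let b : ℕ → ℝ := fun n => n.casesOn C fun m => 2 * (1 / 2) ^ m
  have hu : ∀ n ω, |u n ω| ≤ b n := by
    rintro (_ | m) ω
    · exact hC _ ⟨_, rfl⟩
    · have h1 := hkε m ω
      have h2 := hkε (m + 1) ω
      have h3 : (1 / 2 : ℝ) ^ (m + 1) ≤ (1 / 2) ^ m :=
        pow_le_pow_of_le_one (by norm_num) (by norm_num) (Nat.le_succ m)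
      change |G (m + 1) ω - G m ω| ≤ 2 * (1 / 2) ^ m
      change |g ω - G m ω| < _ at h1
      change |g ω - G (m + 1) ω| < _ at h2
      rw [abs_lt] at h1 h2
      rw [abs_le]
      constructor <;> linarith
  have hb : Summable b := by
    rw [← summable_nat_add_iff 1]
    exact summable_geometric_two.mul_left 2
  refine ⟨k, u, b, hk, fun n => measurable_sigmaOn_of_dependsOn ?_, hu, hb, fun ω => ?_⟩
  · cases n with
    | zero => exact dependsOn_truncate _ _ _
    | succ m =>
      have h1 : DependsOn (G (m + 1)) (window i (k (m + 1)) : Set NegInt) :=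
        dependsOn_truncate _ _ _
      have h2 : DependsOn (G m) (window i (k (m + 1)) : Set NegInt) := by
        refine (dependsOn_truncate η (window i (k m)) g).mono fun j hj => ?_
        rw [Finset.mem_coe, mem_window] at hj ⊢
        have := hk (Nat.lt_add_one m)
        exact ⟨by omega, hj.2⟩
      intro x y h
      change G (m + 1) x - G m x = G (m + 1) y - G m y
      rw [h1 h, h2 h]
  · have hs : Summable fun n => u n ω := hb.of_norm_bounded fun n => hu n ω
    rw [hs.hasSum_iff_tendsto_nat, ← tendsto_add_atTop_iff_nat 1]
    have hsum : ∀ n, ∑ m ∈ Finset.range (n + 1), u m ω = G n ω := by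
      intro n
      rw [Finset.sum_range_succ']
      change ∑ m ∈ Finset.range n, (G (m + 1) ω - G m ω) + G 0 ω = G n ω
      rw [Finset.sum_range_sub (fun m => G m ω)]
      ring
    simp only [hsum]
    rw [tendsto_iff_dist_tendsto_zero]
    refine squeeze_zero (fun _ => dist_nonneg) (fun n => ?_)
      (tendsto_pow_atTop_nhds_zero_of_lt_one (r := (1 / 2 : ℝ)) (by norm_num) (by norm_num))
    rw [dist_comm, Real.dist_eq]
    exact (hkε n ω).le

/-! ### A potential with prescribed energies -/

/-- Only the windows ending at one of the finitely many sites `j ∈ [i, 0]` meet `[i, 0]`; this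
makes both the summability at `i` and the energy of `[i, 0]` finite sums over `j` of convergent
series. -/
theorem exists_potential_energy_eq_sum {α : Type*} [Finite α] [MeasurableSpace α]
    [DiscreteMeasurableSpace α] [TopologicalSpace α] [DiscreteTopology α] [Nonempty α]
    {g : NegInt → Config α → ℝ} (hg : ∀ i, Continuous (g i))
    (hd : ∀ i, DependsOn (g i) (Set.Iic i)) :
    ∃ φ : Potential α, φ.IsSummable ∧
      ∀ i ω, φ.energy (Finset.Ici i) ω = ∑ j ∈ Finset.Ici i, g j ω := by
  choose k u b hk hm hu hb hs using fun i => exists_hasSum_window (hg i) (hd i)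
  -- Distinct pairs give distinct windows, so the terms of all the expansions can be placed on
  -- distinct sets `A` and `φ` vanishes on the remaining sets.
  let w : NegInt × ℕ → Finset NegInt := fun p => window p.1 (k p.1 p.2)
  have hw : Function.Injective w := by
    rintro ⟨i, m⟩ ⟨j, n⟩ h
    have h1 := window_injective (a₁ := (i, k i m)) (a₂ := (j, k j n)) h
    rw [Prod.mk.injEq] at h1
    obtain ⟨rfl, h2⟩ := h1
    rw [(hk i).injective h2]
  let φ : Potential α :=
    { toFun := Function.extend w (fun p => u p.1 p.2) 0
      measurable := by
        intro A
        by_cases hA : ∃ p, w p = A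
        · obtain ⟨p, rfl⟩ := hA
          rw [hw.extend_apply]
          exact hm p.1 p.2
        · rw [Function.extend_apply' _ _ _ hA]
          exact measurable_const }
  have hφ : ∀ p, φ.toFun (w p) = u p.1 p.2 := fun p =>
    hw.extend_apply (fun p => u p.1 p.2) 0 p
  have hφ0 : ∀ A, A ∉ Set.range w → φ.toFun A = 0 := fun A hA =>
    Function.extend_apply' (fun p : NegInt × ℕ => u p.1 p.2) (0 : Finset NegInt → _) A hA
  refine ⟨φ, fun i => ?_, fun i ω => ?_⟩
  · let N : Finset NegInt → ENNReal := fun A => ⨆ ω, ‖φ.toFun A ω‖ₑ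
    have hN : ∀ p, N (w p) ≤ ENNReal.ofReal (b p.1 p.2) := fun p => iSup_le fun ω => by
      rw [hφ, ← ofReal_norm]
      exact ENNReal.ofReal_le_ofReal (hu p.1 p.2 ω)
    calc ∑' A : {A : Finset NegInt // i ∈ A}, N A.1
        = ∑' A, {A : Finset NegInt | i ∈ A}.indicator N A := tsum_subtype _ N
      _ = ∑' p, {A : Finset NegInt | i ∈ A}.indicator N (w p) := by
          refine (hw.tsum_eq fun A hA => ?_).symm
          by_contra h
          have : N A = 0 := by simp [N, hφ0 A h]
          exact hA (by simp [Set.indicator, this])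
      _ ≤ ∑' p : NegInt × ℕ, if i ≤ p.1 then ENNReal.ofReal (b p.1 p.2) else 0 := by
          refine ENNReal.tsum_le_tsum fun p => ?_
          by_cases h : i ∈ w p
          · rw [Set.indicator_of_mem (show w p ∈ {A : Finset NegInt | i ∈ A} from h),
              if_pos (mem_window.1 h).2]
            exact hN p
          · rw [Set.indicator_of_notMem (show w p ∉ {A : Finset NegInt | i ∈ A} from h)]
            exact zero_le
      _ = ∑' j, ∑' n, if i ≤ j then ENNReal.ofReal (b j n) else 0 := ENNReal.tsum_prod'
      _ = ∑ j ∈ Finset.Ici i, ∑' n, if i ≤ j then ENNReal.ofReal (b j n) else 0 := by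
          refine tsum_eq_sum fun j hj => ?_
          rw [Finset.mem_Ici] at hj
          simp [hj]
      _ < ⊤ := by
          refine ENNReal.sum_lt_top.2 fun j hj => ?_
          rw [Finset.mem_Ici] at hj
          simpa [hj] using (hb j).tsum_ofReal_lt_top
  · have hcol : ∀ j, HasSum (fun p : NegInt × ℕ => if p.1 = j then u p.1 p.2 ω else 0)
        (g j ω) := by
      intro j
      have hinj : Function.Injective fun n : ℕ => (j, n) := Prod.mk_right_injective j
      rw [← hinj.hasSum_iff]
      · simpa [Function.comp_def] using hs j ω
      · rintro ⟨j', n⟩ h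
        refine if_neg ?_
        rintro rfl
        exact h ⟨n, rfl⟩
    have hall := hasSum_sum (s := Finset.Ici i) fun j _ => hcol j
    refine HasSum.tsum_eq ?_
    change HasSum ((fun A => φ.toFun A ω) ∘
      ((↑) : {A : Finset NegInt | (A ∩ Finset.Ici i).Nonempty} → Finset NegInt)) _
    rw [hasSum_subtype_iff_indicator, ← hw.hasSum_iff]
    · convert hall using 2 with p
      by_cases h : i ≤ p.1
      · rw [Function.comp_apply, Set.indicator_of_mem
          (show w p ∈ {A : Finset NegInt | (A ∩ Finset.Ici i).Nonempty} from
            window_inter_Ici_nonempty.2 h), hφ, Finset.sum_ite_eq, if_pos (Finset.mem_Ici.2 h)]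
      · rw [Function.comp_apply, Set.indicator_of_notMem
          (show w p ∉ {A : Finset NegInt | (A ∩ Finset.Ici i).Nonempty} from
            fun h' => h (window_inter_Ici_nonempty.1 h')), Finset.sum_ite_eq,
          if_neg (fun h' => h (Finset.mem_Ici.1 h'))]
    · intro A hA
      simp [Set.indicator, hφ0 A hA]

/-! ### Normalization of products of transition probabilities -/

/-- Summation over the coordinates in `insert i Λ`, with the one at `i` taken first. -/
theorem sum_concat_insert {α : Type*} [Fintype α] {Λ : Finset NegInt} {i : NegInt} (hi : i ∉ Λ)
    (ω : Config α) (F : Config α → ℝ) :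
    ∑ σ : (↥(insert i Λ) → α), F (concat (insert i Λ) σ ω) =
      ∑ a, ∑ σ : (Λ → α), F (concat Λ σ (Function.update ω i a)) := by
  rw [← Fintype.sum_prod_type']
  refine Finset.sum_nbij'
    (fun σ => (σ ⟨i, Finset.mem_insert_self i Λ⟩, fun j => σ ⟨j.1, Finset.mem_insert_of_mem j.2⟩))
    (fun p j => if h : j.1 ∈ Λ then p.2 ⟨j.1, h⟩ else p.1)
    (by simp) (by simp) ?_ ?_ ?_
  · intro σ _
    funext j
    by_cases h : j.1 ∈ Λ
    · simp [h]
    · have : j.1 = i := (Finset.mem_insert.1 j.2).resolve_right h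
      simp only [h, dite_false]
      congr 1
      exact Subtype.ext this.symm
  · rintro ⟨a, σ⟩ _
    simp [hi]
  · intro σ _
    congr 1
    funext j
    unfold concat
    by_cases h : j ∈ Λ
    · simp [h]
    · by_cases hj : j = i
      · subst hj; simp [h]
      · simp [h, hj]

namespace LSS

variable {α : Type*} [MeasurableSpace α] (f : LSS α)

theorem dependsOn_prob [MeasurableSingletonClass α] (i : NegInt) (a : α) :
    DependsOn (f.prob i a) (Set.Iio i) := by
  have hB : MeasurableSet[sigmaOn α (Set.Iic i)] {σ : Config α | σ i = a} :=
    measurable_cylinderEvent_apply (X := fun _ => α) Set.self_mem_Iic (measurableSet_singleton a)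
  intro x y h
  exact congrArg ENNReal.toReal (dependsOn_of_measurable_sigmaOn (f.measurable_past i _ hB) h)

theorem sum_prob [Fintype α] [MeasurableSingletonClass α] (i : NegInt) (ω : Config α) :
    ∑ a, f.prob i a ω = 1 := by
  let _ : MeasurableSpace (Config α) := sigmaOn α (Set.Iic i)
  have hB : ∀ a, MeasurableSet {σ : Config α | σ i = a} := fun a =>
    measurable_cylinderEvent_apply (X := fun _ => α) Set.self_mem_Iic (measurableSet_singleton a)
  have := f.isProbability i ω
  have h : ∑ a, f.kernel i ω {σ | σ i = a} = 1 := by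
    rw [← tsum_fintype (L := .unconditional _), ← measure_iUnion _ hB]
    · convert measure_univ (μ := f.kernel i ω)
      ext σ
      simp
    · intro a b hab
      exact Set.disjoint_left.2 fun σ h1 h2 => hab (h1.symm.trans h2)
  unfold prob
  rw [← ENNReal.toReal_sum fun a _ => measure_ne_top _ _, h, ENNReal.toReal_one]

/-- The interaction energy `-log f_i(ω_i | ω)` of the site `i` with its past. -/
noncomputable def siteEnergy (i : NegInt) (ω : Config α) : ℝ :=
  -Real.log (f.prob i (ω i) ω)

theorem dependsOn_siteEnergy [MeasurableSingletonClass α] (i : NegInt) :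
    DependsOn (f.siteEnergy i) (Set.Iic i) := by
  intro x y h
  unfold siteEnergy
  rw [h i Set.self_mem_Iic, f.dependsOn_prob i (y i) fun j hj => h j (Set.Iio_subset_Iic_self hj)]

variable {f}

theorem IsRegular.continuous_siteEnergy [TopologicalSpace α] [DiscreteTopology α]
    (hf : f.IsRegular) (i : NegInt) : Continuous (f.siteEnergy i) := by
  refine (Continuous.log ?_ fun ω => (hf.2 i (ω i) ω).ne').neg
  have h : Continuous fun p : α × Config α => f.prob i p.1 p.2 :=
    continuous_prod_of_discrete_left.2 fun a => hf.1 i a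
  exact h.comp (f := fun ω => (ω i, ω)) ((continuous_apply i).prodMk continuous_id)

theorem exp_neg_siteEnergy (hf : f.IsNonNull) (i : NegInt) (ω : Config α) :
    Real.exp (-f.siteEnergy i ω) = f.prob i (ω i) ω := by
  rw [siteEnergy, neg_neg, Real.exp_log (hf i (ω i) ω)]

/-- If `i` lies to the left of `Λ`, then resampling `Λ` leaves the energy of the site `i` fixed. -/
theorem sum_exp_neg_insert [Fintype α] [MeasurableSingletonClass α] (hf : f.IsNonNull)
    {Λ : Finset NegInt} {i : NegInt} (hi : ∀ j ∈ Λ, i < j) (ω : Config α) :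
    ∑ σ : (Λ → α), Real.exp (-∑ j ∈ insert i Λ, f.siteEnergy j (concat Λ σ ω)) =
      f.prob i (ω i) ω *
        ∑ σ : (Λ → α), Real.exp (-∑ j ∈ Λ, f.siteEnergy j (concat Λ σ ω)) := by
  rw [Finset.mul_sum]
  refine Finset.sum_congr rfl fun σ _ => ?_
  have h : f.siteEnergy i (concat Λ σ ω) = f.siteEnergy i ω := by
    refine f.dependsOn_siteEnergy i fun j hj => ?_
    exact dif_neg fun hΛ => (hi j hΛ).not_ge hj
  rw [Finset.sum_insert fun hΛ => (hi i hΛ).false, neg_add, Real.exp_add, h,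
    exp_neg_siteEnergy hf]

/-- The products of transition probabilities over `Λ` sum to `1`: the leftmost site of `Λ` is split
off, which leaves the product over the other sites with a boundary condition that includes it. -/
theorem sum_exp_neg_siteEnergy [Fintype α] [MeasurableSingletonClass α] (hf : f.IsNonNull)
    (Λ : Finset NegInt) (ω : Config α) :
    ∑ σ : (Λ → α), Real.exp (-∑ j ∈ Λ, f.siteEnergy j (concat Λ σ ω)) = 1 := by
  induction Λ using Finset.induction_on_min generalizing ω with
  | empty => simp
  | insert i Λ hi ih =>
    rw [sum_concat_insert (fun hΛ => (hi i hΛ).false) ω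
      fun ω' => Real.exp (-∑ j ∈ insert i Λ, f.siteEnergy j ω')]
    refine Eq.trans (Finset.sum_congr rfl fun a _ => ?_) (f.sum_prob i ω)
    rw [sum_exp_neg_insert hf hi, ih, mul_one, Function.update_self]
    exact f.dependsOn_prob i a fun j hj => Function.update_of_ne (ne_of_lt hj) _ _

end LSS

end HalfLine

theorem mainTheorem4 {α : Type*} [Fintype α] [MeasurableSpace α] [DiscreteMeasurableSpace α]
    [TopologicalSpace α] [DiscreteTopology α] (f : HalfLine.LSS α) (hf : f.IsRegular) :
    ∃ φ : HalfLine.Potential α, φ.IsSummable ∧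
      ∀ (i : HalfLine.NegInt) (ω : HalfLine.Config α),
        f.prob i (ω i) ω =
          (∑ σ : (Finset.Ioi i → α),
              Real.exp (-φ.energy (Finset.Ici i) (HalfLine.concat (Finset.Ioi i) σ ω))) /
            (∑ σ : (Finset.Ici i → α),
              Real.exp (-φ.energy (Finset.Ici i) (HalfLine.concat (Finset.Ici i) σ ω))) := by
  -- Over the empty alphabet there are no configurations, and the zero potential will do.
  rcases isEmpty_or_nonempty α with hα | hα
  · exact ⟨⟨fun _ _ => 0, fun _ => measurable_const⟩, fun i => by simp,
      fun i ω => hα.elim (ω i)⟩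
  obtain ⟨φ, hφ, hE⟩ := HalfLine.exists_potential_energy_eq_sum
    (fun i => hf.continuous_siteEnergy i) f.dependsOn_siteEnergy
  refine ⟨φ, hφ, fun i ω => ?_⟩
  simp only [hE]
  have h := HalfLine.LSS.sum_exp_neg_insert hf.2 (Λ := Finset.Ioi i)
    (fun j hj => Finset.mem_Ioi.1 hj) ω
  rw [Finset.Ioi_insert, HalfLine.LSS.sum_exp_neg_siteEnergy hf.2, mul_one] at h
  rw [HalfLine.LSS.sum_exp_neg_siteEnergy hf.2, h, div_one]
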